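/- Let $n\ge 1$, let $\Omega_0$ (states) and $\mathbb{Y}^1,\dots,\mathbb{Y}^n$ (the players' measurements) be standard Borel spaces, and let $\zeta$ be a probability measure on $\Omega_0$. Let $\mu$ and $\nu$ be information structures with prior $\zeta$, that is, Borel probability measures on $\Omega_0\times\mathbb{Y}^1\times\dots\times\mathbb{Y}^n$ whose marginal on $\Omega_0$ is $\zeta$. Assume that $\mu$ admits an independent static reduction: there are $\sigma$-finite measures $\mu_0$ on $\Omega_0$ and $\bar Q^i$ on $\mathbb{Y}^i$ ($i=1,\dots,n$) with $$\mu \ll \mu_0\otimes\bar Q^1\otimes\dots\otimes\bar Q^n .$$ A team problem $(c,\mathbb{U}^1,\dots,\mathbb{U}^n)$ consists of nonempty compact metrizable action spaces $\mathbb{U}^i$ and a bounded measurable cost $c:\Omega_0\times\mathbb{U}^1\times\dots\times\mathbb{U}^n\to\mathbb{R}$ such that $c(\omega_0,\cdot)$ is continuous for every $\omega_0\in\Omega_0$. A team policy is a tuple of measurable maps $\gamma^i:\mathbb{Y}^i\to\mathbb{U}^i$. We say that $\mu$ is more informative than $\nu$ if for every team problem $$\inf_{\gamma^1,\dots,\gamma^n}\int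 c\big(\omega_0,\gamma^1(y^1),\dots,\gamma^n(y^n)\big)\,d\mu\ \le\ \inf_{\gamma^1,\dots,\gamma^n}\int c\big(\omega_0,\gamma^1(y^1),\dots,\gamma^n(y^n)\big)\,d\nu ,$$ where the infima are over all team policies. We say that $\nu$ is a correlated garbling of $\mu$ if there are a Borel probability measure $\eta$ on $\mathcal{W}=[0,1]^n$ and stochastic kernels $\Pi^k$ from $\mathbb{Y}^k\times\mathcal{W}$ to $\mathbb{Y}^k$ ($k=1,\dots,n$) such that for every measurable $B\subseteq\Omega_0\times\mathbb{Y}^1\times\dots\times\mathbb{Y}^n$ $$\nu(B)=\int\!\!\int\!\!\int \mathbf{1}_B(\omega_0,\tilde y^1,\dots,\tilde y^n)\,\prod_{k=1}^n\Pi^k(d\tilde y^k\mid y^k,z)\;\mu(d\omega_0,dy^1,\dots,dy^n)\,\eta(dz).$$ Then $\mu$ is more informative than $\nu$ if and only if $\nu$ is a correlated garbling of $\mu$. -/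

import Mathlib

open MeasureTheory ProbabilityTheory

universe u v w

/-- Independent static reduction: the information structure `μ` (a joint law of the state and of
the measurements) is absolutely continuous with respect to a product of σ-finite reference
measures. By σ-finiteness the Radon–Nikodym derivative then exists. -/
def HasIndependentReduction {n : ℕ} {Ω₀ : Type u} [MeasurableSpace Ω₀]
    {Y : Fin n → Type v} [∀ i, MeasurableSpace (Y i)]
    (μ : Measure (Ω₀ × (∀ i, Y i))) : Prop :=
  ∃ (μ₀ : Measure Ω₀) (Q : ∀ i, Measure (Y i)),
    SigmaFinite μ₀ ∧ (∀ i, SigmaFinite (Q i)) ∧ μ ≪ μ₀.prod (Measure.pi Q)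

/-- Admissible team policies: one measurable map from measurements to actions per player. -/
def TeamPolicy {n : ℕ} (Y : Fin n → Type v) [∀ i, MeasurableSpace (Y i)]
    (U : Fin n → Type w) [∀ i, MeasurableSpace (U i)] : Type (max v w) :=
  ∀ i, {γ : Y i → U i // Measurable γ}

/-- Costs: jointly measurable, bounded, and continuous in the joint action for every state. -/
structure IsTeamCost {n : ℕ} {Ω₀ : Type u} [MeasurableSpace Ω₀]
    {U : Fin n → Type w} [∀ i, TopologicalSpace (U i)] [∀ i, MeasurableSpace (U i)]
    (c : Ω₀ × (∀ i, U i) → ℝ) : Prop where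
  measurable : Measurable c
  bounded : ∃ M : ℝ, ∀ p, |c p| ≤ M
  continuous_action : ∀ ω, Continuous fun u : (∀ i, U i) => c (ω, u)

/-- The expected cost `J` of a team policy under the information structure `μ`. -/
noncomputable def expectedCost {n : ℕ} {Ω₀ : Type u} [MeasurableSpace Ω₀]
    {Y : Fin n → Type v} [∀ i, MeasurableSpace (Y i)]
    {U : Fin n → Type w} [∀ i, MeasurableSpace (U i)]
    (c : Ω₀ × (∀ i, U i) → ℝ) (μ : Measure (Ω₀ × (∀ i, Y i))) (γ : TeamPolicy Y U) : ℝ :=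
  ∫ p, c (p.1, fun i => (γ i).1 (p.2 i)) ∂μ

/-- `μ` is more informative than `ν`: in every team problem with nonempty compact (metrizable)
action spaces and an admissible cost, the infimum of the expected cost over all team policies is
at most as large under `μ` as under `ν`. -/
def MoreInformative {n : ℕ} {Ω₀ : Type u} [MeasurableSpace Ω₀]
    {Y : Fin n → Type v} [∀ i, MeasurableSpace (Y i)]
    (μ ν : Measure (Ω₀ × (∀ i, Y i))) : Prop :=
  ∀ (U : Fin n → Type w) [∀ i, Nonempty (U i)] [∀ i, TopologicalSpace (U i)]
    [∀ i, CompactSpace (U i)] [∀ i, TopologicalSpace.MetrizableSpace (U i)]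
    [∀ i, MeasurableSpace (U i)] [∀ i, BorelSpace (U i)]
    (c : Ω₀ × (∀ i, U i) → ℝ), IsTeamCost c →
      ⨅ γ : TeamPolicy Y U, expectedCost c μ γ ≤ ⨅ γ : TeamPolicy Y U, expectedCost c ν γ

/-- `ν` is a correlated garbling of `μ`: there are a law `η` of the common randomness on
`[0,1]^n` and, for each player `k`, a stochastic kernel from `Y k × [0,1]^n` to `Y k` such that
`ν B = ∫ 1_B(ω, y') ∏ₖ Π k (dy'ₖ | yₖ, z) μ(dω, dy) η(dz)` for all measurable `B`. -/
def IsCorrelatedGarbling {n : ℕ} {Ω₀ : Type u} [MeasurableSpace Ω₀]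
    {Y : Fin n → Type v} [∀ i, MeasurableSpace (Y i)]
    (ν μ : Measure (Ω₀ × (∀ i, Y i))) : Prop :=
  ∃ (η : Measure (Fin n → unitInterval))
    (K : ∀ k, Kernel (Y k × (Fin n → unitInterval)) (Y k)),
    IsProbabilityMeasure η ∧ (∀ k, IsMarkovKernel (K k)) ∧
    ∀ B : Set (Ω₀ × (∀ i, Y i)), MeasurableSet B →
      ν B = ∫⁻ p : (Ω₀ × (∀ i, Y i)) × (Fin n → unitInterval),
        Measure.pi (fun k => K k (p.1.2 k, p.2)) {y' | (p.1.1, y') ∈ B} ∂(μ.prod η)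

/-!
A garbling of `μ` is a policy change: represent each garbling kernel by a measurable function of the
measurement, the common noise and a private uniform variable. The cost of a policy under `ν` is then
an average, over all the noises, of costs of deterministic policies under `μ`, so one of these does
at least as well (`moreInformative_of_isCorrelatedGarbling`).

For the converse, consider only teams whose actions lie in `[0,1]` and let the players of `ν` report
their measurements, encoded in `[0,1]`. Randomized strategies of player `k`, identified with
couplings of the reference law `Q k` and an action law, form a compact metrizable space in the weak
topology (`exists_compact_strategies`). The point where the independent reduction matters is that
the expected cost under `μ` is *jointly* continuous in the profile of strategies: against the
product of the reference measures it factorizes over the players, and a density is an `L¹`-limit of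
combinations of boxes (`continuous_integral_mul_prod`). Since deterministic policies are among the
randomized ones, more informativeness says that the expectation of a cost under `ν` is at most its
supremum over profiles (`MoreInformative.sum_le`). Hahn-Banach and Riesz-Markov-Kakutani turn this
into an equality with an average over profiles
(`exists_isProbabilityMeasure_integral_eq`). The averaging measure is the law of the common
randomness. Products of continuous functions determine a measure on the product, so the law of the
reports is the one produced by the garbling, and decoding the reports gives `ν`
(`isCorrelatedGarbling_of_moreInformative`).

The profile space is standard Borel, hence can be encoded in `[0,1]^n` when `n ≥ 1`, and
disintegration with parameters makes the behavioural strategies jointly measurable in the profile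
and the measurements.
-/

open scoped unitInterval BoundedContinuousFunction

/-! ### Reference probability measures -/

/-- Absolute continuity passes to finite products of σ-finite measures. -/
lemma absolutelyContinuous_pi : ∀ {n : ℕ} {Y : Fin n → Type v} [∀ i, MeasurableSpace (Y i)]
    (P Q : ∀ i, Measure (Y i)) [∀ i, SigmaFinite (P i)] [∀ i, SigmaFinite (Q i)]
    (_ : ∀ i, P i ≪ Q i), Measure.pi P ≪ Measure.pi Q
  | 0, Y, _, P, Q, _, _, _ => by
    rw [Measure.pi_of_empty P, Measure.pi_of_empty Q]
  | n + 1, Y, _, P, Q, _, _, h => by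
    have hP := (measurePreserving_piFinSuccAbove P 0).symm
    have hQ := (measurePreserving_piFinSuccAbove Q 0).symm
    rw [← hP.map_eq, ← hQ.map_eq]
    refine Measure.AbsolutelyContinuous.map ?_ (MeasurableEquiv.measurable _)
    exact (h 0).prod (absolutelyContinuous_pi _ _ fun i => h _)

/-- The σ-finite reference measures of an independent reduction can be replaced by probability
measures with the same null sets. -/
lemma HasIndependentReduction.exists_isProbabilityMeasure {n : ℕ} {Ω₀ : Type u}
    [MeasurableSpace Ω₀] {Y : Fin n → Type v} [∀ i, MeasurableSpace (Y i)]
    {μ : Measure (Ω₀ × (∀ i, Y i))} [IsProbabilityMeasure μ] (h : HasIndependentReduction μ) :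
    ∃ (μ₀ : Measure Ω₀) (Q : ∀ i, Measure (Y i)), IsProbabilityMeasure μ₀ ∧
      (∀ i, IsProbabilityMeasure (Q i)) ∧ μ ≪ μ₀.prod (Measure.pi Q) := by
  obtain ⟨μ₀, Q, hμ₀, hQ, hac⟩ := h
  have hne : μ₀.prod (Measure.pi Q) ≠ 0 := by
    intro h0
    rw [h0, Measure.absolutelyContinuous_zero_iff] at hac
    exact IsProbabilityMeasure.ne_zero μ hac
  have hμ₀0 : NeZero μ₀ := ⟨fun h0 => hne (by simp [h0])⟩
  have hQ0 : ∀ i, NeZero (Q i) := fun i => ⟨fun h0 => hne (by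
    have : Measure.pi Q = 0 := by
      rw [← Measure.measure_univ_eq_zero, Measure.pi_univ]
      exact Finset.prod_eq_zero (Finset.mem_univ i) (by simp [h0])
    simp [this])⟩
  refine ⟨μ₀.toFinite, fun i => (Q i).toFinite, inferInstance, fun i => inferInstance, ?_⟩
  exact hac.trans ((absolutelyContinuous_toFinite μ₀).prod
    (absolutelyContinuous_pi _ _ fun i => absolutelyContinuous_toFinite (Q i)))

/-! ### Joint continuity in the strategies -/

section Continuity

variable {R : Type*} {n : ℕ} {Ω₀ : Type u} {Y : Fin n → Type v}
  {G : ∀ k, R → Y k → ℝ} {C : Fin n → ℝ}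

lemma abs_prod_comp_le (hC : ∀ k r y, |G k r y| ≤ C k) (r : R) (y : ∀ k, Y k) :
    ‖∏ k, G k r (y k)‖ ≤ ∏ k, C k := by
  rw [Real.norm_eq_abs, Finset.abs_prod]
  exact Finset.prod_le_prod (fun _ _ => abs_nonneg _) fun k _ => hC k r _

variable [MeasurableSpace Ω₀] [∀ i, MeasurableSpace (Y i)]

lemma measurable_prod_comp (hG : ∀ k r, Measurable (G k r)) (r : R) :
    Measurable fun p : Ω₀ × (∀ k, Y k) => ∏ k, G k r (p.2 k) :=
  Finset.measurable_prod _ fun k _ => (hG k r).comp ((measurable_pi_apply k).comp measurable_snd)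

lemma integrable_mul_prod_comp (hG : ∀ k r, Measurable (G k r)) (hC : ∀ k r y, |G k r y| ≤ C k)
    {m : Measure (Ω₀ × (∀ k, Y k))} {h : Ω₀ × (∀ k, Y k) → ℝ} (hh : Integrable h m) (r : R) :
    Integrable (fun p => h p * ∏ k, G k r (p.2 k)) m :=
  hh.mul_bdd (measurable_prod_comp hG r).aestronglyMeasurable
    (.of_forall fun p => abs_prod_comp_le hC r p.2)

variable [TopologicalSpace R] {μ₀ : Measure Ω₀} [IsProbabilityMeasure μ₀]
  {Q : ∀ i, Measure (Y i)} [∀ i, IsProbabilityMeasure (Q i)]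

/-- The set version of `continuous_integral_mul_prod`. On boxes the integral factorizes; the other
measurable sets follow by Dynkin's π-λ theorem, countable disjoint unions being handled by uniform
convergence in `r`. -/
lemma continuous_setIntegral_prod (hG : ∀ k r, Measurable (G k r))
    (hC : ∀ k r y, |G k r y| ≤ C k)
    (hcont : ∀ k B, MeasurableSet B → Continuous fun r => ∫ y in B, G k r y ∂Q k)
    {T : Set (Ω₀ × (∀ k, Y k))} (hT : MeasurableSet T) :
    Continuous fun r => ∫ p in T, ∏ k, G k r (p.2 k) ∂(μ₀.prod (Measure.pi Q)) := by
  have hint : ∀ r, Integrable (fun p : Ω₀ × (∀ k, Y k) => ∏ k, G k r (p.2 k))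
      (μ₀.prod (Measure.pi Q)) := fun r => by
    simpa using integrable_mul_prod_comp hG hC (integrable_const (1 : ℝ)) r
  have hbox : ∀ (S : Set Ω₀) (B : ∀ k, Set (Y k)), (∀ k, MeasurableSet (B k)) →
      Continuous fun r => ∫ p in S ×ˢ (Set.univ.pi B), ∏ k, G k r (p.2 k)
        ∂(μ₀.prod (Measure.pi Q)) := by
    intro S B hB
    have : ∀ r, ∫ p in S ×ˢ (Set.univ.pi B), ∏ k, G k r (p.2 k) ∂(μ₀.prod (Measure.pi Q))
        = μ₀.real S * ∏ k, ∫ y in B k, G k r y ∂Q k := by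
      intro r
      rw [← Measure.prod_restrict, Measure.restrict_pi_pi]
      have := integral_prod_mul (μ := μ₀.restrict S)
        (ν := Measure.pi fun k => (Q k).restrict (B k))
        (fun _ => (1 : ℝ)) (fun y => ∏ k, G k r (y k))
      simp only [one_mul] at this
      rw [this, integral_fintype_prod_eq_prod]
      simp
    simp_rw [this]
    exact continuous_const.mul (continuous_finsetProd _ fun k _ => hcont k _ (hB k))
  have hgen : (inferInstance : MeasurableSpace (Ω₀ × (∀ k, Y k))) =
      MeasurableSpace.generateFrom (Set.image2 (fun x1 x2 => x1 ×ˢ x2) {s | MeasurableSet s}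
        (Set.univ.pi '' Set.univ.pi fun i => {s : Set (Y i) | MeasurableSet s})) :=
    (generateFrom_eq_prod MeasurableSpace.generateFrom_measurableSet generateFrom_pi
      isCountablySpanning_measurableSet
      (IsCountablySpanning.pi fun i => isCountablySpanning_measurableSet)).symm
  induction T, hT using MeasurableSpace.induction_on_inter hgen
    (IsPiSystem.prod MeasurableSpace.isPiSystem_measurableSet isPiSystem_pi) with
  | empty => simpa using continuous_const
  | basic T hT =>
    obtain ⟨S, -, _, ⟨B, hB, rfl⟩, rfl⟩ := hT
    exact hbox S B fun k => hB k (Set.mem_univ k)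
  | compl T hT ih =>
    have huniv := hbox Set.univ (fun _ => Set.univ) fun _ => MeasurableSet.univ
    simp only [Set.pi_univ, Set.univ_prod_univ, setIntegral_univ] at huniv
    simp_rw [setIntegral_compl hT (hint _)]
    exact huniv.sub ih
  | iUnion T hd hT ih =>
    simp_rw [fun r => integral_iUnion hT hd (hint r).integrableOn]
    refine continuous_tsum ih
      (u := fun i => (∏ k, C k) * (μ₀.prod (Measure.pi Q)).real (T i)) ?_ ?_
    · refine Summable.mul_left _ ?_
      refine ENNReal.summable_toReal ?_
      rw [← measure_iUnion hd hT]
      exact measure_ne_top _ _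
    · intro i r
      exact norm_setIntegral_le_of_norm_le_const (measure_lt_top _ _)
        (fun p _ => abs_prod_comp_le hC r p.2)

/-- Joint continuity in the strategies: integrals of products of functions of the separate
coordinates against an integrable weight depend continuously on the parameter as soon as each
factor does so in the weak-* sense. The weight plays the role of the Radon-Nikodym density of the
information structure. -/
lemma continuous_integral_mul_prod (hG : ∀ k r, Measurable (G k r))
    (hC : ∀ k r y, |G k r y| ≤ C k)
    (hcont : ∀ k B, MeasurableSet B → Continuous fun r => ∫ y in B, G k r y ∂Q k)
    {h : Ω₀ × (∀ k, Y k) → ℝ} (hh : Integrable h (μ₀.prod (Measure.pi Q))) :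
    Continuous fun r => ∫ p, h p * ∏ k, G k r (p.2 k) ∂(μ₀.prod (Measure.pi Q)) := by
  refine Integrable.induction (P := fun h => Continuous fun r =>
    ∫ p, h p * ∏ k, G k r (p.2 k) ∂(μ₀.prod (Measure.pi Q))) ?_ ?_ ?_ ?_ hh
  · intro c s hs _
    have : ∀ r, ∫ p, s.indicator (fun _ => c) p * ∏ k, G k r (p.2 k) ∂(μ₀.prod (Measure.pi Q))
        = c * ∫ p in s, ∏ k, G k r (p.2 k) ∂(μ₀.prod (Measure.pi Q)) := fun r => by
      rw [← integral_const_mul, ← integral_indicator hs]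
      congr 1 with p
      rw [Set.indicator_mul_left]
    simp_rw [this]
    exact continuous_const.mul (continuous_setIntegral_prod hG hC hcont hs)
  · intro f g _ hf hg ihf ihg
    simp_rw [Pi.add_apply, add_mul]
    simp_rw [fun r => integral_add (integrable_mul_prod_comp hG hC hf r)
      (integrable_mul_prod_comp hG hC hg r)]
    exact ihf.add ihg
  · refine isClosed_of_closure_subset fun f hf => ?_
    refine continuous_of_uniform_approx_of_continuous fun W hW => ?_
    obtain ⟨ε, hε, hεW⟩ := Metric.mem_uniformity_dist.1 hW
    set M : ℝ := |∏ k, C k| + 1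
    have hM : 0 < M := by positivity
    obtain ⟨g, hg, hfg⟩ := Metric.mem_closure_iff.1 hf (ε / M) (by positivity)
    refine ⟨_, hg, fun r => hεW ?_⟩
    have hif := L1.integrable_coeFn f
    have hig := L1.integrable_coeFn g
    rw [dist_eq_norm, ← integral_sub (integrable_mul_prod_comp hG hC hif r)
      (integrable_mul_prod_comp hG hC hig r)]
    calc _ ≤ ∫ p, ‖f p - g p‖ * M ∂(μ₀.prod (Measure.pi Q)) := by
          refine norm_integral_le_of_norm_le ((hif.sub hig).norm.mul_const M)
            (.of_forall fun p => ?_)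
          rw [← sub_mul, norm_mul]
          gcongr
          exact (abs_prod_comp_le hC r p.2).trans ((le_abs_self _).trans (by simp [M]))
      _ = dist f g * M := by
          rw [integral_mul_const, L1.dist_eq_integral_dist]
          simp_rw [dist_eq_norm]
      _ < ε := by rwa [lt_div_iff₀ hM] at hfg
  · intro f g hfg _ ih
    refine ih.congr fun r => integral_congr_ae ?_
    filter_upwards [hfg] with p hp
    rw [hp]

end Continuity

/-! ### Relaxed strategies -/

section Young

/-- Evaluation of probability measures on a fixed measurable set is Borel measurable for the weak
topology. It suffices to check closed sets, where the evaluation is a pointwise limit of the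
continuous integrals of thickened indicators. -/
lemma measurable_toMeasure_of_continuous {R X : Type*} [TopologicalSpace R] [MeasurableSpace R]
    [BorelSpace R] [TopologicalSpace X] [TopologicalSpace.MetrizableSpace X] [MeasurableSpace X]
    [BorelSpace X] {f : R → ProbabilityMeasure X} (hf : Continuous f) :
    Measurable fun r => (f r : Measure X) := by
  have hgen : (inferInstance : MeasurableSpace X) =
      MeasurableSpace.generateFrom {s : Set X | IsClosed s} := by
    rw [← borel_eq_generateFrom_isClosed]
    exact BorelSpace.measurable_eq
  refine Measurable.measure_of_isPiSystem_of_isProbabilityMeasure hgen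
    isPiSystem_isClosed fun F hF => ?_
  have hF : IsClosed F := hF
  refine measurable_of_tendsto_metrizable
    (f := fun k r => ∫⁻ x, hF.apprSeq k x ∂(f r : Measure X)) (fun k => ?_) ?_
  · exact ((ProbabilityMeasure.continuous_lintegral_boundedContinuousFunction _).comp
      hf).measurable
  · rw [tendsto_pi_nhds]
    exact fun r => HasOuterApproxClosed.tendsto_lintegral_apprSeq hF _

/-- Relaxed strategies of a player whose measurement, encoded in `[0,1]`, has law `Q` and whose
actions lie in `[0,1]`: couplings with first marginal `Q`, with the weak topology. -/
def RelaxedStrategy (Q : ProbabilityMeasure I) : Type :=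
  {π : ProbabilityMeasure (I × I) // π.map measurable_fst.aemeasurable = Q}

variable (Q : ProbabilityMeasure I)

noncomputable instance : TopologicalSpace (RelaxedStrategy Q) :=
  instTopologicalSpaceSubtype

instance : TopologicalSpace.MetrizableSpace (RelaxedStrategy Q) :=
  Topology.IsEmbedding.subtypeVal.metrizableSpace

/-- The Borel σ-algebra of the weak topology. -/
noncomputable instance : MeasurableSpace (RelaxedStrategy Q) := borel _

instance : BorelSpace (RelaxedStrategy Q) := ⟨rfl⟩

instance : CompactSpace (RelaxedStrategy Q) :=
  isCompact_iff_compactSpace.1 (IsClosed.isCompact (isClosed_eq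
    (ProbabilityMeasure.continuous_map continuous_fst) continuous_const))

lemma continuous_relaxedStrategy_val :
    Continuous fun r : RelaxedStrategy Q => r.1 := continuous_subtype_val

/-- The coupling, as a kernel depending on the relaxed strategy. -/
noncomputable def couplingKernel : Kernel (RelaxedStrategy Q) (I × I) where
  toFun r := r.1
  measurable' := measurable_toMeasure_of_continuous (continuous_relaxedStrategy_val Q)

instance : IsMarkovKernel (couplingKernel Q) := ⟨fun r => inferInstanceAs
  (IsProbabilityMeasure (r.1 : Measure (I × I)))⟩

lemma couplingKernel_fst (r : RelaxedStrategy Q) : (couplingKernel Q).fst r = Q := by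
  rw [Kernel.fst_apply]
  have := congrArg ProbabilityMeasure.toMeasure r.2
  simpa [couplingKernel] using this

/-- The behavioural form of a relaxed strategy: the conditional law of the action given the
measurement, jointly measurable in the strategy and the measurement. -/
noncomputable def actionKernel : Kernel (RelaxedStrategy Q × I) I := (couplingKernel Q).condKernel

instance : IsMarkovKernel (actionKernel Q) :=
  inferInstanceAs (IsMarkovKernel (couplingKernel Q).condKernel)

instance : (couplingKernel Q).IsCondKernel (actionKernel Q) :=
  inferInstanceAs ((couplingKernel Q).IsCondKernel (couplingKernel Q).condKernel)

lemma compProd_actionKernel (r : RelaxedStrategy Q) :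
    (Q : Measure I) ⊗ₘ ((actionKernel Q).sectR r) = (r.1 : Measure (I × I)) := by
  have h := congrArg (fun κ : Kernel _ _ => κ r) ((couplingKernel Q).disintegrate (actionKernel Q))
  simp only [Kernel.compProd_apply_eq_compProd_sectR, couplingKernel_fst] at h
  exact h

lemma setIntegral_actionKernel (r : RelaxedStrategy Q) {B : Set I} (hB : MeasurableSet B)
    (g : C(I, ℝ)) :
    ∫ y in B, ∫ u, g u ∂actionKernel Q (r, y) ∂(Q : Measure I) =
      ∫ p, B.indicator 1 p.1 * g p.2 ∂(r.1 : Measure (I × I)) := by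
  have hg : Integrable (fun p : I × I => g p.2) (r.1 : Measure (I × I)) :=
    (BoundedContinuousFunction.mkOfCompact (g.comp ContinuousMap.snd)).integrable _
  have h := Measure.setIntegral_compProd (μ := (Q : Measure I)) (κ := (actionKernel Q).sectR r)
    hB MeasurableSet.univ (f := fun p : I × I => g p.2)
    (by rw [compProd_actionKernel]; exact hg.integrableOn)
  rw [compProd_actionKernel] at h
  simp only [Measure.restrict_univ, Kernel.sectR_apply] at h
  rw [← h, ← integral_indicator (hB.prod MeasurableSet.univ)]
  congr 1 with p
  by_cases hp : p.1 ∈ B <;> simp [hp]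

lemma integral_fst_relaxedStrategy (r : RelaxedStrategy Q) {f : I → ℝ}
    (hf : AEStronglyMeasurable f (Q : Measure I)) :
    ∫ p, f p.1 ∂(r.1 : Measure (I × I)) = ∫ y, f y ∂(Q : Measure I) := by
  have h : (r.1 : Measure (I × I)).map Prod.fst = Q :=
    congrArg ProbabilityMeasure.toMeasure r.2
  rw [← h] at hf ⊢
  rw [integral_map measurable_fst.aemeasurable hf]

/-- The weak topology on couplings with a fixed first marginal tests against functions that are
merely measurable in the first variable: these are `L¹`-limits of continuous ones, uniformly over
the couplings. -/
lemma continuous_setIntegral_actionKernel {B : Set I} (hB : MeasurableSet B)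
    (g : C(I, ℝ)) :
    Continuous fun r : RelaxedStrategy Q =>
      ∫ y in B, ∫ u, g u ∂actionKernel Q (r, y) ∂(Q : Measure I) := by
  simp_rw [fun r => setIntegral_actionKernel Q r hB g]
  refine continuous_of_uniform_approx_of_continuous fun W hW => ?_
  obtain ⟨ε, hε, hεW⟩ := Metric.mem_uniformity_dist.1 hW
  have hint : Integrable (B.indicator (1 : I → ℝ)) (Q : Measure I) :=
    (integrable_const (1 : ℝ)).indicator hB
  obtain ⟨φ, hφ, -⟩ := hint.exists_boundedContinuous_integral_sub_le
    (ε := ε / (2 * (‖g‖ + 1))) (by positivity)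
  refine ⟨fun r => ∫ p, φ p.1 * g p.2 ∂(r.1 : Measure (I × I)), ?_, fun r => hεW ?_⟩
  · exact (ProbabilityMeasure.continuous_integral_continuousMap
      ((φ.toContinuousMap.comp ContinuousMap.fst) * (g.comp ContinuousMap.snd))).comp
      (continuous_relaxedStrategy_val Q)
  have hg : AEStronglyMeasurable (fun p : I × I => g p.2) (r.1 : Measure (I × I)) :=
    (g.continuous.comp continuous_snd).aestronglyMeasurable
  have hgb : ∀ᵐ p : I × I ∂(r.1 : Measure (I × I)), ‖g p.2‖ ≤ ‖g‖ :=
    .of_forall fun p => g.norm_coe_le_norm _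
  have h1 : Integrable (fun p : I × I => B.indicator (1 : I → ℝ) p.1) (r.1 : Measure (I × I)) :=
    (integrable_const (1 : ℝ)).indicator (measurable_fst hB)
  have h2 : Integrable (fun p : I × I => φ p.1) (r.1 : Measure (I × I)) :=
    (φ.compContinuous ContinuousMap.fst).integrable _
  rw [dist_eq_norm, ← integral_sub (h1.mul_bdd hg hgb) (h2.mul_bdd hg hgb)]
  calc _ ≤ ∫ p, ‖B.indicator (1 : I → ℝ) p.1 - φ p.1‖ * (‖g‖ + 1) ∂(r.1 : Measure (I × I)) := by
        refine norm_integral_le_of_norm_le ((h1.sub h2).norm.mul_const _) (.of_forall fun p => ?_)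
        rw [← sub_mul, norm_mul]
        gcongr
        linarith [g.norm_coe_le_norm p.2]
    _ = (∫ y, ‖B.indicator (1 : I → ℝ) y - φ y‖ ∂(Q : Measure I)) * (‖g‖ + 1) := by
        rw [integral_mul_const, integral_fst_relaxedStrategy Q r
          (f := fun y => ‖B.indicator (1 : I → ℝ) y - φ y‖)
          (hint.aestronglyMeasurable.sub (φ.integrable _).aestronglyMeasurable).norm]
    _ ≤ ε / (2 * (‖g‖ + 1)) * (‖g‖ + 1) := by gcongr
    _ = ε / 2 := by field_simp
    _ < ε := by linarith

/-- Deterministic strategies are relaxed strategies. -/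
lemma exists_actionKernel_eq_dirac {γ : I → I} (hγ : Measurable γ) :
    ∃ r : RelaxedStrategy Q,
      ∀ᵐ y ∂(Q : Measure I), actionKernel Q (r, y) = Measure.dirac (γ y) := by
  have hm : Measurable fun y => (y, γ y) := measurable_id.prodMk hγ
  let r : RelaxedStrategy Q := ⟨Q.map hm.aemeasurable, by
    apply ProbabilityMeasure.toMeasure_injective
    rw [ProbabilityMeasure.toMeasure_map, ProbabilityMeasure.toMeasure_map,
      Measure.map_map measurable_fst hm]
    exact Measure.map_id⟩
  refine ⟨r, ?_⟩
  have h : (Q : Measure I) ⊗ₘ ((actionKernel Q).sectR r)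
      = (Q : Measure I) ⊗ₘ (Kernel.deterministic γ hγ) := by
    rw [compProd_actionKernel, Measure.compProd_deterministic]
    rfl
  filter_upwards [Kernel.ae_eq_of_compProd_eq h] with y hy
  rw [← Kernel.sectR_apply, hy, Kernel.deterministic_apply]

end Young

/-- **Compactness of relaxed strategies.** For a player with measurement law `Q` there is a compact
metrizable space of randomized strategies with actions in `[0,1]`, given by one jointly measurable
kernel, which is continuous in the weak-* sense and contains all deterministic strategies. -/
lemma exists_compact_strategies {Y : Type*} [MeasurableSpace Y] [StandardBorelSpace Y]
    (Q : Measure Y) [IsProbabilityMeasure Q] :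
    ∃ (R : Type) (_ : TopologicalSpace R) (_ : MeasurableSpace R) (κ : Kernel (R × Y) I),
      BorelSpace R ∧ CompactSpace R ∧ TopologicalSpace.MetrizableSpace R ∧ IsMarkovKernel κ ∧
      (∀ B, MeasurableSet B → ∀ g : C(I, ℝ),
        Continuous fun r => ∫ y in B, ∫ u, g u ∂κ (r, y) ∂Q) ∧
      ∀ γ : Y → I, Measurable γ → ∃ r, ∀ᵐ y ∂Q, κ (r, y) = Measure.dirac (γ y) := by
  have : Nonempty Y := Q.nonempty_of_neZero
  have he := measurableEmbedding_sigmoid_comp_embeddingReal Y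
  set e := unitInterval.sigmoid ∘ embeddingReal Y
  let Q' : ProbabilityMeasure I :=
    ⟨Q.map e, Measure.isProbabilityMeasure_map he.measurable.aemeasurable⟩
  have hm : Measurable fun p : RelaxedStrategy Q' × Y => (p.1, e p.2) :=
    measurable_fst.prodMk (he.measurable.comp measurable_snd)
  refine ⟨RelaxedStrategy Q', inferInstance, inferInstance, (actionKernel Q').comap _ hm,
    inferInstance, inferInstance, inferInstance, inferInstance, fun B hB g => ?_, fun γ hγ => ?_⟩
  · refine (continuous_setIntegral_actionKernel Q' (he.measurableSet_image.2 hB) g).congr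
      fun r => ?_
    change ∫ y in e '' B, ∫ u, g u ∂actionKernel Q' (r, y) ∂(Q.map e) = _
    rw [he.setIntegral_map, Set.preimage_image_eq _ he.injective]
    rfl
  · obtain ⟨r, hr⟩ := exists_actionKernel_eq_dirac Q' (hγ.comp he.measurable_invFun)
    refine ⟨r, ?_⟩
    filter_upwards [ae_of_ae_map he.measurable.aemeasurable hr] with y hy
    rw [Kernel.comap_apply, hy, Function.comp_apply, he.leftInverse_invFun]

/-! ### Minimax representation -/

/-- **Minimax representation.** If a linear functional `L` is dominated by the supremum of the
continuous functions `Φ v` on a compact space, then it is an average of the evaluations of `Φ`.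
Hahn-Banach is applied on `V × C(R, ℝ)`, which avoids having to factor `L` through the range of
`Φ`; the extension is a positive functional on `C(R, ℝ)`, hence a measure. -/
lemma exists_isProbabilityMeasure_integral_eq {R : Type*} [TopologicalSpace R] [CompactSpace R]
    [T2Space R] [MeasurableSpace R] [BorelSpace R] [Nonempty R] {V : Type*} [AddCommGroup V]
    [Module ℝ V] (Φ : V →ₗ[ℝ] C(R, ℝ)) (L : V →ₗ[ℝ] ℝ)
    (h : ∀ v a, (∀ r, Φ v r ≤ a) → L v ≤ a) :
    ∃ η : Measure R, IsProbabilityMeasure η ∧ ∀ v, L v = ∫ r, Φ v r ∂η := by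
  let N : V × C(R, ℝ) → ℝ := fun p => ⨆ r, (Φ p.1 + p.2) r
  have hbdd : ∀ g : C(R, ℝ), BddAbove (Set.range g) := fun g =>
    (isCompact_range g.continuous).bddAbove
  have hle : ∀ p r, (Φ p.1 + p.2) r ≤ N p := fun p r => le_ciSup (hbdd (Φ p.1 + p.2)) r
  let f : (V × C(R, ℝ)) →ₗ.[ℝ] ℝ :=
    ⟨Submodule.prod ⊤ ⊥, (L ∘ₗ LinearMap.fst ℝ V C(R, ℝ)) ∘ₗ Submodule.subtype _⟩
  obtain ⟨F, hFf, hFN⟩ := exists_extension_of_le_sublinear f N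
    (fun c hc p => by
      simp only [N, Real.mul_iSup_of_nonneg hc.le]
      congr 1 with r
      simp [mul_add])
    (fun p q => ciSup_le fun r => by
      have := add_le_add (hle p r) (hle q r)
      simp only [ContinuousMap.add_apply, Prod.fst_add, Prod.snd_add, map_add] at this ⊢
      rw [add_add_add_comm]
      exact this)
    (fun ⟨p, hp⟩ => h _ _ fun r => by
      have hp2 : p.2 = 0 := hp.2
      have := hle p r
      rwa [hp2, add_zero] at this)
  have hFL : ∀ v, F (v, 0) = L v := fun v => hFf ⟨(v, 0), Submodule.mem_top, Submodule.zero_mem _⟩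
  have hFle : ∀ v g a, (∀ r, Φ v r + g r ≤ a) → F (v, g) ≤ a := fun v g a ha =>
    (hFN _).trans (ciSup_le ha)
  have hsplit : ∀ v g, F (v, g) = L v + F (0, g) := fun v g => by
    rw [← hFL, ← map_add]
    simp
  have hneg : ∀ g, F (0, -g) = -F (0, g) := fun g => by
    rw [← map_neg]
    simp
  have hFΦ : ∀ v, F (0, Φ v) = L v := by
    have key : ∀ v, L v ≤ F (0, Φ v) := fun v => by
      have := hFle v (-Φ v) 0 (by simp)
      rw [hsplit, hneg] at this
      linarith
    intro v
    have := key (-v)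
    rw [map_neg, map_neg, hneg] at this
    exact le_antisymm (by linarith) (key v)
  have hpos : ∀ g : C(R, ℝ), 0 ≤ g → 0 ≤ F (0, g) := fun g hg => by
    have := hFle 0 (-g) 0 fun r => by simpa using hg r
    rw [hneg] at this
    linarith
  have hone : F (0, 1) = 1 := by
    have h1 := hFle 0 1 1 (by simp)
    have h2 := hFle 0 (-1) (-1) (by simp)
    rw [hneg] at h2
    linarith
  let Λ : CompactlySupportedContinuousMap R ℝ →ₚ[ℝ] ℝ :=
    { toFun g := F (0, g.toContinuousMap)
      map_add' g g' := by
        rw [← map_add]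
        simp only [Prod.mk_add_mk, add_zero]
        rfl
      map_smul' c g := by
        rw [RingHom.id_apply, ← map_smul]
        simp only [Prod.smul_mk, smul_zero]
        rfl
      monotone' g g' hgg' := by
        have := hpos (g'.toContinuousMap - g.toContinuousMap) (fun r => by
          simpa using hgg' r)
        have h2 : ((0 : V), g'.toContinuousMap - g.toContinuousMap)
            = (0, g'.toContinuousMap) - (0, g.toContinuousMap) := by simp
        rw [h2, map_sub] at this
        linarith }
  have hint : ∀ g : C(R, ℝ), ∫ r, g r ∂(RealRMK.rieszMeasure Λ) = F (0, g) := fun g =>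
    RealRMK.integral_rieszMeasure Λ ⟨g, HasCompactSupport.of_compactSpace _⟩
  refine ⟨RealRMK.rieszMeasure Λ, ⟨?_⟩, fun v => by rw [hint, hFΦ]⟩
  have := hint 1
  simp only [ContinuousMap.one_apply, integral_const, smul_eq_mul, mul_one, hone] at this
  rw [Measure.real, ENNReal.toReal_eq_one_iff] at this
  exact this

/-! ### Garblings as random maps -/

section Garbling

variable {n : ℕ} {Ω₀ : Type u} [MeasurableSpace Ω₀] {Y : Fin n → Type v}
  [∀ i, MeasurableSpace (Y i)] {W : Type*} [MeasurableSpace W] {Z : Fin n → Type*}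
  [∀ i, MeasurableSpace (Z i)]

/-- The outcome of a garbling as a function of state, measurements, common noise, and private
noises, when player `k` generates the new measurement by `φ k` from measurement, common noise and
a private uniform variable. -/
def garblingMap (φ : ∀ k, Y k × W → I → Z k) :
    ((Ω₀ × (∀ i, Y i)) × W) × (Fin n → I) → Ω₀ × (∀ i, Z i) :=
  fun q => (q.1.1.1, fun k => φ k (q.1.1.2 k, q.1.2) (q.2 k))

lemma measurable_garblingMap {φ : ∀ k, Y k × W → I → Z k}
    (hφ : ∀ k, Measurable (Function.uncurry (φ k))) :
    Measurable (garblingMap (Ω₀ := Ω₀) φ) := by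
  refine Measurable.prodMk (by fun_prop) (measurable_pi_lambda _ fun k => ?_)
  exact (hφ k).comp (f := fun q : ((Ω₀ × (∀ i, Y i)) × W) × (Fin n → I) =>
    ((q.1.1.2 k, q.1.2), q.2 k)) (by fun_prop)

/-- The law of the garbled measurements is the iterated integral of the product kernels. -/
lemma map_garblingMap_apply {φ : ∀ k, Y k × W → I → Z k}
    (hφ : ∀ k, Measurable (Function.uncurry (φ k))) {K : ∀ k, Kernel (Y k × W) (Z k)}
    [∀ k, IsMarkovKernel (K k)] (hK : ∀ k x, (volume : Measure I).map (φ k x) = K k x)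
    (m : Measure ((Ω₀ × (∀ i, Y i)) × W)) [SFinite m] {B : Set (Ω₀ × (∀ i, Z i))}
    (hB : MeasurableSet B) :
    (m.prod (volume : Measure (Fin n → I))).map (garblingMap φ) B =
      ∫⁻ p, Measure.pi (fun k => K k (p.1.2 k, p.2)) {z | (p.1.1, z) ∈ B} ∂m := by
  rw [Measure.map_apply (measurable_garblingMap hφ) hB,
    Measure.prod_apply (measurable_garblingMap hφ hB)]
  refine lintegral_congr fun p => ?_
  have hφp : ∀ k, Measurable (φ k (p.1.2 k, p.2)) := fun k => (hφ k).of_uncurry_left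
  have : ∀ k, SigmaFinite ((volume : Measure I).map (φ k (p.1.2 k, p.2))) := fun k => by
    rw [hK]; infer_instance
  simp_rw [← hK]
  have hm : Measurable fun (t : Fin n → I) k => φ k (p.1.2 k, p.2) (t k) :=
    measurable_pi_lambda _ fun k => (hφp k).comp (measurable_pi_apply k)
  rw [← Measure.pi_map_pi (fun k => (hφp k).aemeasurable)]
  exact (Measure.map_apply hm (measurable_prodMk_left (x := p.1.1) hB)).symm

end Garbling

/-! ### Garblings are less informative -/

section

variable {n : ℕ} {Ω₀ : Type u} [MeasurableSpace Ω₀] {Y : Fin n → Type v}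
  [∀ i, MeasurableSpace (Y i)] {U : Fin n → Type w} [∀ i, TopologicalSpace (U i)]
  [∀ i, MeasurableSpace (U i)] {c : Ω₀ × (∀ i, U i) → ℝ}

lemma IsTeamCost.bddBelow_expectedCost (hc : IsTeamCost c) (μ : Measure (Ω₀ × (∀ i, Y i)))
    [IsProbabilityMeasure μ] :
    BddBelow (Set.range fun γ : TeamPolicy Y U => expectedCost c μ γ) := by
  obtain ⟨M, hM⟩ := hc.bounded
  refine ⟨-M, ?_⟩
  rintro _ ⟨γ, rfl⟩
  have : ‖expectedCost c μ γ‖ ≤ M * μ.real Set.univ :=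
    norm_integral_le_of_norm_le_const (.of_forall fun p => hM _)
  rw [probReal_univ, mul_one] at this
  exact (abs_le.1 this).1

instance [∀ i, Nonempty (U i)] : Nonempty (TeamPolicy Y U) :=
  ⟨fun _ => ⟨fun _ => Classical.arbitrary _, measurable_const⟩⟩

/-- Derandomization: under a garbling, the cost of a policy is an average, over the common and the
private noises, of costs of deterministic policies under the original information structure. -/
lemma moreInformative_of_isCorrelatedGarbling [∀ i, StandardBorelSpace (Y i)]
    {μ ν : Measure (Ω₀ × (∀ i, Y i))} [IsProbabilityMeasure μ] [IsProbabilityMeasure ν]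
    (h : IsCorrelatedGarbling ν μ) : MoreInformative.{u, v, w} μ ν := by
  obtain ⟨η, K, hη, hK, hν⟩ := h
  have hY : ∀ k, Nonempty (Y k) := fun k => μ.nonempty_of_neZero.map fun p => p.2 k
  choose φ hφ hφK using fun k => (K k).exists_measurable_map_eq_unitInterval
  have hνmap : ν = ((μ.prod η).prod volume).map (garblingMap φ) := by
    ext B hB
    rw [hν B hB, map_garblingMap_apply hφ hφK _ hB]
  intro U _ _ _ _ _ _ c hc
  refine le_ciInf fun γ => ?_
  obtain ⟨M, hM⟩ := hc.bounded
  have hγ : Measurable fun p : Ω₀ × (∀ i, Y i) => c (p.1, fun i => (γ i).1 (p.2 i)) :=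
    hc.measurable.comp (measurable_fst.prodMk (measurable_pi_lambda _ fun i =>
      (γ i).2.comp ((measurable_pi_apply i).comp measurable_snd)))
  set F : ((Ω₀ × (∀ i, Y i)) × (Fin n → I)) × (Fin n → I) → ℝ :=
    fun q => c (q.1.1.1, fun i => (γ i).1 (φ i (q.1.1.2 i, q.1.2) (q.2 i))) with hF
  have hFm : Measurable F := hγ.comp (measurable_garblingMap hφ)
  have hFi : Integrable F ((μ.prod η).prod volume) :=
    Integrable.of_bound hFm.aestronglyMeasurable M (.of_forall fun q => hM _)
  have hcost : expectedCost c ν γ = ∫ t, ∫ x, F (x, t) ∂(μ.prod η) := by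
    rw [expectedCost, hνmap, integral_map (measurable_garblingMap hφ).aemeasurable
      hγ.aestronglyMeasurable, ← integral_prod_symm _ hFi]
    rfl
  obtain ⟨t, ht⟩ := exists_le_integral hFi.integral_prod_right
  have hFt : Integrable (fun x => F (x, t)) (μ.prod η) :=
    Integrable.of_bound (hFm.comp measurable_prodMk_right).aestronglyMeasurable M
      (.of_forall fun q => hM _)
  rw [integral_prod_symm _ hFt] at ht
  obtain ⟨z, hz⟩ := exists_le_integral hFt.integral_prod_right
  refine (ciInf_le (hc.bddBelow_expectedCost μ)
    (fun i => ⟨fun y => (γ i).1 (φ i (y, z) (t i)), (γ i).2.comp ?_⟩)).trans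
      ((hz.trans ht).trans hcost.ge)
  exact (hφ i).comp (f := fun y => ((y, z), t i)) (by fun_prop)

end

/-! ### Product costs -/

section

variable {n : ℕ} {Ω₀ : Type u} [TopologicalSpace Ω₀]

/-- The separating family of costs for actions in `[0,1]`: products of a bounded continuous
function of the state and continuous functions of the individual actions. -/
def productCost (i : (Ω₀ →ᵇ ℝ) × (Fin n → C(I, ℝ))) (p : Ω₀ × (Fin n → I)) : ℝ :=
  i.1 p.1 * ∏ k, i.2 k (p.2 k)

lemma continuous_productCost (i : (Ω₀ →ᵇ ℝ) × (Fin n → C(I, ℝ))) :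
    Continuous (productCost i) := by
  unfold productCost
  fun_prop

lemma abs_productCost_le (i : (Ω₀ →ᵇ ℝ) × (Fin n → C(I, ℝ))) (p : Ω₀ × (Fin n → I)) :
    |productCost i p| ≤ ‖i.1‖ * ∏ k, ‖i.2 k‖ := by
  rw [productCost, abs_mul, Finset.abs_prod]
  exact mul_le_mul (i.1.norm_coe_le_norm _)
    (Finset.prod_le_prod (fun _ _ => abs_nonneg _) fun k _ => (i.2 k).norm_coe_le_norm _)
    (Finset.prod_nonneg fun _ _ => abs_nonneg _) (norm_nonneg _)

variable [MeasurableSpace Ω₀] [BorelSpace Ω₀]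

lemma measurable_productCost (i : (Ω₀ →ᵇ ℝ) × (Fin n → C(I, ℝ))) :
    Measurable (productCost i) := by
  unfold productCost
  have := i.1.continuous.measurable
  have := fun k => (i.2 k).continuous.measurable
  fun_prop

/-- The cost `-∑ x_i c_i` with product costs `c_i`, on actions in a universe lift of `[0,1]`. -/
lemma isTeamCost_neg_sum (v : ((Ω₀ →ᵇ ℝ) × (Fin n → C(I, ℝ))) →₀ ℝ) :
    IsTeamCost (U := fun _ : Fin n => ULift.{w} I)
      fun p => -∑ i ∈ v.support, v i * productCost i (p.1, fun k => (p.2 k).down) where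
  measurable := by
    refine (Finset.measurable_sum _ fun i _ => ?_).neg
    exact ((measurable_productCost i).comp (measurable_fst.prodMk (measurable_pi_lambda _ fun k =>
      measurable_down.comp ((measurable_pi_apply k).comp measurable_snd)))).const_mul _
  bounded := by
    refine ⟨∑ i ∈ v.support, |v i| * (‖i.1‖ * ∏ k, ‖i.2 k‖), fun p => ?_⟩
    rw [abs_neg]
    refine (Finset.abs_sum_le_sum_abs _ _).trans (Finset.sum_le_sum fun i _ => ?_)
    rw [abs_mul]
    gcongr
    exact abs_productCost_le i _
  continuous_action ω := by
    refine (continuous_finsetSum _ fun i _ => ?_).neg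
    exact continuous_const.mul ((continuous_productCost i).comp (by fun_prop))

variable {Y : Fin n → Type v} [∀ i, MeasurableSpace (Y i)]

lemma integrable_productCost (m : Measure (Ω₀ × (∀ i, Y i))) [IsFiniteMeasure m]
    (i : (Ω₀ →ᵇ ℝ) × (Fin n → C(I, ℝ))) {γ : ∀ k, Y k → I} (hγ : ∀ k, Measurable (γ k)) :
    Integrable (fun p => productCost i (p.1, fun k => γ k (p.2 k))) m :=
  Integrable.of_bound ((measurable_productCost i).comp (measurable_fst.prodMk
    (measurable_pi_lambda _ fun k =>
      (hγ k).comp ((measurable_pi_apply k).comp measurable_snd)))).aestronglyMeasurable _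
    (.of_forall fun _ => abs_productCost_le i _)

lemma expectedCost_neg_sum (m : Measure (Ω₀ × (∀ i, Y i))) [IsFiniteMeasure m]
    (v : ((Ω₀ →ᵇ ℝ) × (Fin n → C(I, ℝ))) →₀ ℝ)
    (γ : TeamPolicy Y fun _ : Fin n => ULift.{w} I) :
    expectedCost (fun p => -∑ i ∈ v.support, v i * productCost i (p.1, fun k => (p.2 k).down)) m γ
      = -∑ i ∈ v.support,
          v i * ∫ p, productCost i (p.1, fun k => ((γ k).1 (p.2 k)).down) ∂m := by
  rw [expectedCost, integral_neg, integral_finsetSum _ fun i _ => (integrable_productCost m i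
    (γ := fun k y => ((γ k).1 y).down) fun k => measurable_down.comp (γ k).2).const_mul _]
  simp_rw [integral_const_mul]

end

section

variable {n : ℕ} {Ω₀ : Type u} [MeasurableSpace Ω₀] [TopologicalSpace Ω₀] [BorelSpace Ω₀]
  {Y : Fin n → Type v} [∀ i, MeasurableSpace (Y i)]
  {R : Fin n → Type} [∀ k, MeasurableSpace (R k)]
  (κ : ∀ k, Kernel (R k × Y k) I)

/-- The expected value of a product cost when the players use the randomized strategies `r k`,
independently of each other. -/
noncomputable def relaxedValue (μ : Measure (Ω₀ × (∀ i, Y i)))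
    (i : (Ω₀ →ᵇ ℝ) × (Fin n → C(I, ℝ))) (r : ∀ k, R k) : ℝ :=
  ∫ p, i.1 p.1 * ∏ k, ∫ u, i.2 k u ∂κ k (r k, p.2 k) ∂μ

lemma measurable_integral_kernel {k : Fin n} (g : C(I, ℝ)) :
    Measurable fun x => ∫ u, g u ∂κ k x :=
  (g.continuous.stronglyMeasurable.integral_kernel (κ := κ k)).measurable

lemma abs_integral_kernel_le [∀ k, IsMarkovKernel (κ k)] {k : Fin n} (g : C(I, ℝ))
    (x : R k × Y k) : |∫ u, g u ∂κ k x| ≤ ‖g‖ := by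
  have : ‖∫ u, g u ∂κ k x‖ ≤ ‖g‖ * (κ k x).real Set.univ :=
    norm_integral_le_of_norm_le_const (.of_forall fun u => g.norm_coe_le_norm u)
  rwa [probReal_univ, mul_one] at this

lemma continuous_relaxedValue [∀ k, TopologicalSpace (R k)] [∀ k, IsMarkovKernel (κ k)]
    {μ : Measure (Ω₀ × (∀ i, Y i))} [IsProbabilityMeasure μ]
    {μ₀ : Measure Ω₀} [IsProbabilityMeasure μ₀] {Q : ∀ i, Measure (Y i)}
    [∀ i, IsProbabilityMeasure (Q i)] (hμ : μ ≪ μ₀.prod (Measure.pi Q))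
    (hcont : ∀ k B, MeasurableSet B → ∀ g : C(I, ℝ),
      Continuous fun r => ∫ y in B, ∫ u, g u ∂κ k (r, y) ∂Q k)
    (i : (Ω₀ →ᵇ ℝ) × (Fin n → C(I, ℝ))) : Continuous (relaxedValue κ μ i) := by
  have h1 : Integrable (fun p => (μ.rnDeriv (μ₀.prod (Measure.pi Q)) p).toReal * i.1 p.1)
      (μ₀.prod (Measure.pi Q)) :=
    Measure.integrable_toReal_rnDeriv.mul_bdd (c := ‖i.1‖)
      (i.1.continuous.measurable.comp measurable_fst).aestronglyMeasurable
      (.of_forall fun p => i.1.norm_coe_le_norm _)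
  refine (continuous_integral_mul_prod (R := ∀ k, R k)
    (G := fun k r y => ∫ u, i.2 k u ∂κ k (r k, y)) (C := fun k => ‖i.2 k‖)
    (fun k r => (measurable_integral_kernel κ (i.2 k)).comp measurable_prodMk_left)
    (fun k r y => abs_integral_kernel_le κ _ _)
    (fun k B hB => (hcont k B hB (i.2 k)).comp (continuous_apply k)) h1).congr fun r => ?_
  rw [relaxedValue, ← integral_rnDeriv_smul hμ]
  simp_rw [smul_eq_mul, mul_assoc]

end

/-! ### Construction of the garbling -/

section

variable {n : ℕ} {Ω₀ : Type u} [MeasurableSpace Ω₀] {Y : Fin n → Type v}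
  [∀ i, MeasurableSpace (Y i)]

/-- Null sets for the reference law of one measurement are null for the information structure. -/
lemma ae_forall_of_absolutelyContinuous_prod_pi {μ : Measure (Ω₀ × (∀ i, Y i))}
    {μ₀ : Measure Ω₀} [SFinite μ₀] {Q : ∀ i, Measure (Y i)} [∀ i, SigmaFinite (Q i)]
    (hμ : μ ≪ μ₀.prod (Measure.pi Q)) {p : ∀ k, Y k → Prop} (hp : ∀ k, ∀ᵐ y ∂Q k, p k y) :
    ∀ᵐ x ∂μ, ∀ k, p k (x.2 k) :=
  hμ.ae_le (ae_all_iff.2 fun k => ((Measure.quasiMeasurePreserving_eval Q k).comp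
    Measure.quasiMeasurePreserving_snd).ae (hp k))

variable [TopologicalSpace Ω₀] [BorelSpace Ω₀]
  {R : Fin n → Type} [∀ k, MeasurableSpace (R k)]
  (κ : ∀ k, Kernel (R k × Y k) I)

/-- The domination hypothesis of the minimax representation: more informativeness bounds every
combination of product costs under `ν`, the players reporting their measurements `e k`, by its
supremum over independent randomized strategies under `μ`. -/
lemma MoreInformative.sum_le {μ ν : Measure (Ω₀ × (∀ i, Y i))} [IsProbabilityMeasure μ]
    [IsProbabilityMeasure ν] (h : MoreInformative.{u, v, w} μ ν)
    {μ₀ : Measure Ω₀} [IsProbabilityMeasure μ₀] {Q : ∀ i, Measure (Y i)}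
    [∀ i, IsProbabilityMeasure (Q i)] (hμ : μ ≪ μ₀.prod (Measure.pi Q))
    (hdet : ∀ k, ∀ γ : Y k → I, Measurable γ →
      ∃ r, ∀ᵐ y ∂Q k, κ k (r, y) = Measure.dirac (γ y))
    {e : ∀ k, Y k → I} (he : ∀ k, Measurable (e k))
    (v : ((Ω₀ →ᵇ ℝ) × (Fin n → C(I, ℝ))) →₀ ℝ) (a : ℝ)
    (ha : ∀ r, ∑ i ∈ v.support, v i * relaxedValue κ μ i r ≤ a) :
    ∑ i ∈ v.support, v i * ∫ p, productCost i (p.1, fun k => e k (p.2 k)) ∂ν ≤ a := by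
  have hc := isTeamCost_neg_sum.{u, w} v
  let γe : TeamPolicy Y fun _ : Fin n => ULift.{w} I :=
    fun k => ⟨fun y => ULift.up (e k y), measurable_up.comp (he k)⟩
  have hν := ciInf_le (hc.bddBelow_expectedCost ν) γe
  rw [expectedCost_neg_sum ν v γe] at hν
  have hμ' : -a ≤ ⨅ γ : TeamPolicy Y fun _ : Fin n => ULift.{w} I, expectedCost
      (fun p => -∑ i ∈ v.support, v i * productCost i (p.1, fun k => (p.2 k).down)) μ γ := by
    refine le_ciInf fun γ => ?_
    rw [expectedCost_neg_sum]
    choose r hr using fun k => hdet k (fun y => ((γ k).1 y).down) (measurable_down.comp (γ k).2)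
    refine neg_le_neg (le_of_eq_of_le (Finset.sum_congr rfl fun i _ => ?_) (ha r))
    congr 1
    refine integral_congr_ae ?_
    filter_upwards [ae_forall_of_absolutelyContinuous_prod_pi hμ hr] with x hx
    simp_rw [hx, integral_dirac]
    rfl
  have := hμ'.trans ((h _ _ hc).trans hν)
  linarith

end

/-- Under an independent reduction, more informativeness forces the existence of a garbling. -/
lemma isCorrelatedGarbling_of_moreInformative {n : ℕ} (hn : 1 ≤ n)
    {Ω₀ : Type u} [MeasurableSpace Ω₀] [StandardBorelSpace Ω₀]
    {Y : Fin n → Type v} [∀ i, MeasurableSpace (Y i)] [∀ i, StandardBorelSpace (Y i)]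
    {μ ν : Measure (Ω₀ × (∀ i, Y i))} [IsProbabilityMeasure μ] [IsProbabilityMeasure ν]
    (hμ : HasIndependentReduction μ) (h : MoreInformative.{u, v, w} μ ν) :
    IsCorrelatedGarbling ν μ := by
  obtain ⟨μ₀, Q, hμ₀, hQ, hac⟩ := hμ.exists_isProbabilityMeasure
  let := upgradeStandardBorel Ω₀
  have hY : ∀ k, Nonempty (Y k) := fun k => (Q k).nonempty_of_neZero
  choose R tR mR κ bR cR metR markR hcont hdet using fun k => exists_compact_strategies (Q k)
  have hpol : ∀ k, PolishSpace (R k) := fun k => by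
    let := TopologicalSpace.metrizableSpaceMetric (R k)
    infer_instance
  have hR : ∀ k, Nonempty (R k) := fun k =>
    (hdet k (fun _ => 0) measurable_const).nonempty
  -- The action of player `k` is a report of the measurement, encoded in `[0,1]`.
  let e : ∀ k, Y k → I := fun k => unitInterval.sigmoid ∘ embeddingReal (Y k)
  have he : ∀ k, MeasurableEmbedding (e k) := fun k =>
    measurableEmbedding_sigmoid_comp_embeddingReal (Y k)
  have hval := continuous_relaxedValue κ hac hcont
  obtain ⟨ηR, hηR, hint⟩ := exists_isProbabilityMeasure_integral_eq (R := ∀ k, R k)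
    (Finsupp.linearCombination ℝ fun i => (⟨relaxedValue κ μ i, hval i⟩ : C(∀ k, R k, ℝ)))
    (Finsupp.linearCombination ℝ fun i => ∫ p, productCost i (p.1, fun k => e k (p.2 k)) ∂ν)
    (fun v a ha => by
      rw [Finsupp.linearCombination_apply, Finsupp.sum]
      refine h.sum_le κ hac hdet (fun k => (he k).measurable) v a fun r => ?_
      simpa [Finsupp.linearCombination_apply, Finsupp.sum] using ha r)
  have hint : ∀ i, ∫ p, productCost i (p.1, fun k => e k (p.2 k)) ∂ν
      = ∫ r, relaxedValue κ μ i r ∂ηR := fun i => by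
    simpa using hint (Finsupp.single i 1)
  -- The common noise on `[0,1]^n` encodes the strategy profile; only the first coordinate is used.
  have hs := measurableEmbedding_sigmoid_comp_embeddingReal (∀ k, R k)
  let j : (∀ k, R k) → Fin n → I := fun r _ => (unitInterval.sigmoid ∘ embeddingReal _) r
  let dec : (Fin n → I) → ∀ k, R k := fun z => hs.invFun (z ⟨0, hn⟩)
  have hj : Measurable j := measurable_pi_lambda _ fun _ => hs.measurable
  have hdec : Measurable dec := hs.measurable_invFun.comp (measurable_pi_apply _)
  have hdecj : ∀ r, dec (j r) = r := fun r => hs.leftInverse_invFun r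
  have hη : IsProbabilityMeasure (ηR.map j) := Measure.isProbabilityMeasure_map hj.aemeasurable
  have hm : ∀ k, Measurable fun x : Y k × (Fin n → I) => (dec x.2 k, x.1) := fun k => by fun_prop
  let K' : ∀ k, Kernel (Y k × (Fin n → I)) I := fun k => (κ k).comap _ (hm k)
  have hd : ∀ k, Measurable (he k).invFun := fun k => (he k).measurable_invFun
  choose φ hφ hφK using fun k => (K' k).exists_measurable_map_eq_unitInterval
  have hem : Measurable fun p : Ω₀ × (∀ k, Y k) => (p.1, fun k => e k (p.2 k)) :=
    measurable_fst.prodMk (measurable_pi_lambda _ fun k =>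
      (he k).measurable.comp ((measurable_pi_apply k).comp measurable_snd))
  have hdm : Measurable fun p : Ω₀ × (Fin n → I) => (p.1, fun k => (he k).invFun (p.2 k)) :=
    measurable_fst.prodMk (measurable_pi_lambda _ fun k =>
      (hd k).comp ((measurable_pi_apply k).comp measurable_snd))
  have hlaw : ν.map (fun p => (p.1, fun k => e k (p.2 k)))
      = ((μ.prod (ηR.map j)).prod volume).map (garblingMap φ) := by
    have := Measure.isProbabilityMeasure_map (μ := ν) hem.aemeasurable
    have := Measure.isProbabilityMeasure_map (μ := (μ.prod (ηR.map j)).prod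
      (volume : Measure (Fin n → I))) (measurable_garblingMap hφ).aemeasurable
    refine Measure.ext_of_integral_mul_prod_boundedContinuousFunction fun f g => ?_
    let i : (Ω₀ →ᵇ ℝ) × (Fin n → C(I, ℝ)) := (f, fun k => (g k).toContinuousMap)
    have him := measurable_productCost i
    change ∫ p, productCost i p ∂_ = ∫ p, productCost i p ∂_
    rw [integral_map hem.aemeasurable him.aestronglyMeasurable, hint i,
      integral_map (measurable_garblingMap hφ).aemeasurable him.aestronglyMeasurable,
      integral_prod (fun x => productCost i (garblingMap φ x)) (Integrable.of_bound
        (him.comp (measurable_garblingMap hφ)).aestronglyMeasurable _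
        (.of_forall fun _ => abs_productCost_le i _))]
    -- Integrating out the private noises gives the behavioural strategies.
    have hinner : ∀ x : (Ω₀ × (∀ k, Y k)) × (Fin n → I),
        ∫ t, productCost i (garblingMap φ (x, t)) =
          i.1 x.1.1 * ∏ k, ∫ u, i.2 k u ∂κ k (dec x.2 k, x.1.2 k) := fun x => by
      simp only [productCost, garblingMap]
      rw [integral_const_mul, volume_pi,
        integral_fintype_prod_eq_prod (fun k t => i.2 k (φ k (x.1.2 k, x.2) t))]
      congr 2 with k
      have := hφK k (x.1.2 k, x.2)
      rw [Kernel.comap_apply] at this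
      rw [← this, integral_map (hφ k).of_uncurry_left.aemeasurable
        (i.2 k).continuous.aestronglyMeasurable]
    simp_rw [hinner]
    rw [integral_prod_symm]
    · change _ = ∫ z, relaxedValue κ μ i (dec z) ∂(ηR.map j)
      rw [integral_map (f := fun z => relaxedValue κ μ i (dec z)) hj.aemeasurable
        ((hval i).measurable.comp hdec).aestronglyMeasurable]
      simp_rw [hdecj]
    · refine Integrable.of_bound (C := ‖i.1‖ * ∏ k, ‖i.2 k‖) ?_ (.of_forall fun x => ?_)
      · refine ((i.1.continuous.measurable.comp (measurable_fst.comp measurable_fst)).mul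
          (Finset.measurable_prod _ fun k _ => (measurable_integral_kernel κ (i.2 k)).comp
            (f := fun x : (Ω₀ × (∀ k, Y k)) × (Fin n → I) => (dec x.2 k, x.1.2 k))
            (by fun_prop))).aestronglyMeasurable
      · rw [norm_mul]
        exact mul_le_mul (i.1.norm_coe_le_norm _)
          (abs_prod_comp_le (R := Unit) (G := fun k _ x => ∫ u, i.2 k u ∂κ k x)
            (fun k _ _ => abs_integral_kernel_le κ _ _) () (fun k => (dec x.2 k, x.1.2 k)))
          (norm_nonneg _) (norm_nonneg _)
  -- Decoding the actions turns the reports into measurements.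
  refine ⟨ηR.map j, fun k => (K' k).map (he k).invFun, hη,
    fun k => Kernel.IsMarkovKernel.map _ (hd k), fun B hB => ?_⟩
  have hψ : ∀ k, Measurable (Function.uncurry fun x t => (he k).invFun (φ k x t)) := fun k =>
    (hd k).comp (hφ k)
  have : ∀ k, IsMarkovKernel ((K' k).map (he k).invFun) := fun k => Kernel.IsMarkovKernel.map _ (hd k)
  rw [← map_garblingMap_apply hψ (K := fun k => (K' k).map (he k).invFun) (fun k x => by
    rw [Kernel.map_apply _ (hd k), ← hφK, Measure.map_map (hd k) (hφ k).of_uncurry_left]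
    rfl) _ hB]
  have hcomp : garblingMap (Ω₀ := Ω₀) (fun k x t => (he k).invFun (φ k x t)) =
      (fun p : Ω₀ × (Fin n → I) => (p.1, fun k => (he k).invFun (p.2 k))) ∘ garblingMap φ := rfl
  rw [hcomp, ← Measure.map_map hdm (measurable_garblingMap hφ), ← hlaw,
    Measure.map_map hdm hem]
  have hid : (fun p : Ω₀ × (Fin n → I) => (p.1, fun k => (he k).invFun (p.2 k))) ∘
      (fun p : Ω₀ × (∀ k, Y k) => (p.1, fun k => e k (p.2 k))) = id := by
    funext p
    simp only [Function.comp_apply, id]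
    refine Prod.ext rfl (funext fun k => (he k).leftInverse_invFun _)
  rw [hid, Measure.map_id]

theorem mainTheorem2 {n : ℕ} (hn : 1 ≤ n)
    {Ω₀ : Type u} [MeasurableSpace Ω₀] [StandardBorelSpace Ω₀]
    {Y : Fin n → Type v} [∀ i, MeasurableSpace (Y i)] [∀ i, StandardBorelSpace (Y i)]
    (ζ : Measure Ω₀) [IsProbabilityMeasure ζ]
    (μ ν : Measure (Ω₀ × (∀ i, Y i))) [IsProbabilityMeasure μ] [IsProbabilityMeasure ν]
    (hμζ : μ.fst = ζ) (hνζ : ν.fst = ζ)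
    (hμ : HasIndependentReduction μ) :
    MoreInformative.{u, v, w} μ ν ↔ IsCorrelatedGarbling ν μ :=
  ⟨isCorrelatedGarbling_of_moreInformative hn hμ, moreInformative_of_isCorrelatedGarbling⟩
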